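/- Let $n\ge 2$ be an integer and let $\mu>1$ be real. Define masks by $a^{(n,0)}_0=a^{(n,0)}_1=\tfrac12$, $a^{(n,0)}_\alpha=0$ otherwise, and, for $m\ge 1$, $$a^{(n,m)}_\alpha=\frac{1}{2^{\,n+1+m^{-\mu}}}\left[\binom{n+1}{\alpha}+4\bigl(2^{m^{-\mu}}-1\bigr)\binom{n-1}{\alpha-1}\right]\quad(0\le\alpha\le n+1),\qquad a^{(n,m)}_\alpha=0\ \text{ otherwise},$$ where $\binom{n-1}{\alpha-1}=0$ for $\alpha-1<0$ or $\alpha-1>n-1$. Let $A^{(n,m)}(z)=\sum_{\alpha}a^{(n,m)}_\alpha z^\alpha$. For $m\ge 0$ let $\varphi^{(n,m)}:\mathbb R\to\mathbb R$ be the refinable function whose Fourier transform $\widehat\varphi(\omega)=\int_{\mathbb R}\varphi(x)e^{-i\omega x}\,dx$ is $$\widehat\varphi^{(n,m)}(\omega)=\prod_{k=m}^{\infty}A^{(n,k)}\bigl(e^{-i\omega/2^{k+1}}\bigr),\qquad\text{i.e.}\qquad \varphi^{(n,m)}(x)=\frac1{2\pi}\int_{\mathbb R}e^{i\omega x}\prod_{k=m}^{\infty}A^{(n,k)}\bigl(e^{-i\omega/2^{k+1}}\bigr)\,d\omega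 .$$ Let $V^{(n,m)}$ be the space of all functions $f:\mathbb R\to\mathbb R$ for which there are real numbers $\gamma_\alpha$, $\alpha\in\mathbb Z$, with $$f(x)=\sum_{\alpha\in\mathbb Z}\gamma_\alpha\,\varphi^{(n,m)}(x-2^{-m}\alpha)\qquad\text{for every }x\in\mathbb R,$$ where the series converges unconditionally at every $x$. Then: (a) for every integer $m>0$, the space $V^{(n,m)}$ contains every real polynomial of degree at most $n-2$; (b) the space $V^{(n,0)}$ contains the constant functions. -/

import Mathlib

/-- The coefficient `a_α^{(n,m)}` of the refinement mask with tension parameter `μ`; the mask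
vanishes at negative indices, so it is indexed by `α : ℕ`. The binomial coefficient
`binom (n-1) (α-1)` is `0` for `α = 0`. -/
noncomputable def rippletMask (n : ℕ) (μ : ℝ) (m α : ℕ) : ℝ :=
  if m = 0 then
    if α ≤ 1 then 1 / 2 else 0
  else
    if α ≤ n + 1 then
      1 / (2 : ℝ) ^ ((n : ℝ) + 1 + (m : ℝ) ^ (-μ)) *
        (((n + 1).choose α : ℝ) +
          4 * ((2 : ℝ) ^ ((m : ℝ) ^ (-μ)) - 1) *
            (if α = 0 then 0 else ((n - 1).choose (α - 1) : ℝ)))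
    else 0

/-- The mask symbol `A^{(n,m)}(z) = ∑_α a_α^{(n,m)} z^α`. -/
noncomputable def rippletSymbol (n : ℕ) (μ : ℝ) (m : ℕ) (z : ℂ) : ℂ :=
  ∑ α ∈ Finset.range (n + 2), (rippletMask n μ m α : ℂ) * z ^ α

/-- The Fourier transform of the refinable function `φ^{(n,m)}` (convention
`∫ φ(x) exp (-i ω x) dx`): the infinite product `∏_{k ≥ m} A^{(n,k)}(exp (-i ω / 2^(k+1)))`. -/
noncomputable def rippletFourier (n : ℕ) (μ : ℝ) (m : ℕ) (ω : ℝ) : ℂ :=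
  ∏' j : ℕ, rippletSymbol n μ (m + j) (Complex.exp (-Complex.I * (ω / 2 ^ (m + j + 1) : ℝ)))

/-- The inverse Fourier transform of the infinite product, as a complex-valued function. -/
noncomputable def rippletC (n : ℕ) (μ : ℝ) (m : ℕ) (x : ℝ) : ℂ :=
  (1 / (2 * Real.pi) : ℝ) *
    ∫ ω : ℝ, Complex.exp (Complex.I * (ω * x : ℝ)) * rippletFourier n μ m ω

/-- The refinable function `φ^{(n,m)}`, with values in `ℝ`; see `ofReal_ripplet`. -/
noncomputable def ripplet (n : ℕ) (μ : ℝ) (m : ℕ) (x : ℝ) : ℝ :=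
  (rippletC n μ m x).re

/-- The space `V^{(n,m)}` spanned by the `2^{-m}`-shifts of `φ^{(n,m)}`: all functions
`∑_{α ∈ ℤ} γ_α φ^{(n,m)}(· - 2^{-m} α)` with real coefficients, the series converging at
every point. -/
def rippletSpace (n : ℕ) (μ : ℝ) (m : ℕ) : Set (ℝ → ℝ) :=
  {f | ∃ γ : ℤ → ℝ, ∀ x : ℝ,
    HasSum (fun α : ℤ => γ α * ripplet n μ m (x - (α : ℝ) / 2 ^ m)) (f x)}

/-! Sanity facts: the mask is nonnegative with sum one, the infinite product converges and takes
the value one at the origin, and the refinable function is real-valued. -/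

theorem rippletMask_nonneg (n : ℕ) (μ : ℝ) (m α : ℕ) : 0 ≤ rippletMask n μ m α := by
  unfold rippletMask
  have h : (1 : ℝ) ≤ (2 : ℝ) ^ ((m : ℝ) ^ (-μ)) :=
    Real.one_le_rpow (by norm_num) (by positivity)
  have h' : (0 : ℝ) ≤ (2 : ℝ) ^ ((m : ℝ) ^ (-μ)) - 1 := by linarith
  split_ifs <;> positivity

theorem sum_rippletMask (n : ℕ) (hn : 1 ≤ n) (μ : ℝ) (m : ℕ) :
    ∑ α ∈ Finset.range (n + 2), rippletMask n μ m α = 1 := by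
  rcases Nat.eq_zero_or_pos m with rfl | hm
  · rw [Finset.sum_range_succ', Finset.sum_range_succ']
    have : ∀ i ∈ Finset.range n, rippletMask n μ 0 (i + 1 + 1) = 0 := by
      intro i _
      simp [rippletMask]
    rw [Finset.sum_eq_zero this]
    norm_num [rippletMask]
  · set ε : ℝ := (m : ℝ) ^ (-μ) with hε
    have h1 : ∑ α ∈ Finset.range (n + 2), ((n + 1).choose α : ℝ) = 2 ^ (n + 1) := by
      exact_mod_cast Nat.sum_range_choose (n + 1)
    have h2 : ∑ α ∈ Finset.range (n + 2),
        (if α = 0 then 0 else ((n - 1).choose (α - 1) : ℝ)) = 2 ^ (n - 1) := by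
      rw [Finset.sum_range_succ']
      simp only [Nat.succ_ne_zero, if_false, Nat.add_sub_cancel, if_true, add_zero]
      rw [Finset.sum_range_succ, Nat.choose_eq_zero_of_lt (by omega)]
      have := Nat.sum_range_choose (n - 1)
      rw [Nat.sub_add_cancel hn] at this
      simpa using (by exact_mod_cast this :
        ∑ α ∈ Finset.range n, ((n - 1).choose α : ℝ) = 2 ^ (n - 1))
    have h3 : ∀ α ∈ Finset.range (n + 2), rippletMask n μ m α =
        1 / (2 : ℝ) ^ ((n : ℝ) + 1 + ε) * (((n + 1).choose α : ℝ) +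
          4 * ((2 : ℝ) ^ ε - 1) * (if α = 0 then 0 else ((n - 1).choose (α - 1) : ℝ))) := by
      intro α hα
      rw [Finset.mem_range] at hα
      rw [rippletMask, if_neg hm.ne', if_pos (by omega)]
    rw [Finset.sum_congr rfl h3, ← Finset.mul_sum, Finset.sum_add_distrib, ← Finset.mul_sum,
      h1, h2, Real.rpow_add two_pos]
    have h4 : (2 : ℝ) ^ ((n : ℝ) + 1) = 4 * 2 ^ (n - 1) := by
      obtain ⟨k, rfl⟩ := Nat.exists_eq_add_of_le' hn
      rw [← Nat.cast_succ, Real.rpow_natCast, Nat.add_sub_cancel, pow_succ, pow_succ]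
      ring
    have h5 : (2 : ℝ) ^ (n + 1) = 4 * 2 ^ (n - 1) := by
      obtain ⟨k, rfl⟩ := Nat.exists_eq_add_of_le' hn
      rw [Nat.add_sub_cancel]
      ring
    have h6 : (2 : ℝ) ^ ε ≠ 0 := (Real.rpow_pos_of_pos two_pos _).ne'
    rw [h4, h5]
    field_simp
    ring

theorem norm_rippletSymbol_sub_one_le (n : ℕ) (hn : 1 ≤ n) (μ : ℝ) (m : ℕ) (θ : ℝ) :
    ‖rippletSymbol n μ m (Complex.exp (-Complex.I * (θ : ℝ))) - 1‖ ≤ (n + 1) * |θ| := by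
  have h1 : (1 : ℂ) = ∑ α ∈ Finset.range (n + 2), (rippletMask n μ m α : ℂ) := by
    exact_mod_cast (sum_rippletMask n hn μ m).symm
  rw [rippletSymbol, h1]
  rw [← Finset.sum_sub_distrib]
  refine (norm_sum_le _ _).trans ?_
  have h2 : ∀ α ∈ Finset.range (n + 2),
      ‖(rippletMask n μ m α : ℂ) * Complex.exp (-Complex.I * (θ : ℝ)) ^ α -
        (rippletMask n μ m α : ℂ)‖ ≤ rippletMask n μ m α * ((n + 1) * |θ|) := by
    intro α hα
    rw [Finset.mem_range] at hα
    have hα' : (α : ℝ) ≤ n + 1 := by exact_mod_cast (by omega : α ≤ n + 1)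
    have e : (rippletMask n μ m α : ℂ) * Complex.exp (-Complex.I * (θ : ℝ)) ^ α -
        (rippletMask n μ m α : ℂ) = (rippletMask n μ m α : ℂ) *
          (Complex.exp (Complex.I * ((-(α * θ) : ℝ) : ℂ)) - 1) := by
      rw [← Complex.exp_nat_mul]
      push_cast
      ring_nf
    rw [e, norm_mul, Complex.norm_real, Real.norm_of_nonneg (rippletMask_nonneg n μ m α)]
    refine mul_le_mul_of_nonneg_left ?_ (rippletMask_nonneg n μ m α)
    refine (Real.norm_exp_I_mul_ofReal_sub_one_le (x := -(α * θ))).trans ?_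
    rw [Real.norm_eq_abs, abs_neg, abs_mul, Nat.abs_cast]
    gcongr
  refine (Finset.sum_le_sum h2).trans ?_
  rw [← Finset.sum_mul, sum_rippletMask n hn, one_mul]

theorem multipliable_rippletFourier (n : ℕ) (hn : 1 ≤ n) (μ : ℝ) (m : ℕ) (ω : ℝ) :
    Multipliable fun j : ℕ => rippletSymbol n μ (m + j)
      (Complex.exp (-Complex.I * (ω / 2 ^ (m + j + 1) : ℝ))) := by
  have hs : Summable fun j : ℕ => ‖rippletSymbol n μ (m + j)
      (Complex.exp (-Complex.I * (ω / 2 ^ (m + j + 1) : ℝ))) - 1‖ := by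
    refine Summable.of_nonneg_of_le (fun _ => norm_nonneg _)
      (fun j => norm_rippletSymbol_sub_one_le n hn μ (m + j) _) ?_
    have : (fun j : ℕ => ((n : ℝ) + 1) * |ω / 2 ^ (m + j + 1)|) =
        fun j : ℕ => (((n : ℝ) + 1) * |ω| / 2 ^ (m + 1)) * (1 / 2) ^ j := by
      funext j
      rw [abs_div, abs_of_pos (by positivity : (0 : ℝ) < 2 ^ (m + j + 1)),
        show m + j + 1 = m + 1 + j by ring, pow_add _ (m + 1) j, one_div, inv_pow]
      field_simp
    rw [this]
    exact summable_geometric_two.mul_left _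
  simpa using multipliable_one_add_of_summable hs

theorem rippletFourier_zero (n : ℕ) (hn : 1 ≤ n) (μ : ℝ) (m : ℕ) :
    rippletFourier n μ m 0 = 1 := by
  have : ∀ k, rippletSymbol n μ k 1 = 1 := by
    intro k
    simp only [rippletSymbol, one_pow, mul_one]
    exact_mod_cast sum_rippletMask n hn μ k
  simp [rippletFourier, this]

theorem rippletFourier_succ (n : ℕ) (hn : 1 ≤ n) (μ : ℝ) (m : ℕ) (ω : ℝ) :
    rippletFourier n μ m ω =
      rippletSymbol n μ m (Complex.exp (-Complex.I * (ω / 2 ^ (m + 1) : ℝ))) *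
        rippletFourier n μ (m + 1) ω := by
  have h := multipliable_rippletFourier n hn μ (m + 1) ω
  have e : (fun j : ℕ => rippletSymbol n μ (m + 1 + j)
        (Complex.exp (-Complex.I * (ω / 2 ^ (m + 1 + j + 1) : ℝ)))) =
      fun j : ℕ => rippletSymbol n μ (m + (j + 1))
        (Complex.exp (-Complex.I * (ω / 2 ^ (m + (j + 1) + 1) : ℝ))) := by
    funext j
    rw [show m + 1 + j = m + (j + 1) by ring]
  unfold rippletFourier
  rw [e] at h ⊢
  exact tprod_eq_zero_mul' h

theorem conj_rippletFourier (n : ℕ) (hn : 1 ≤ n) (μ : ℝ) (m : ℕ) (ω : ℝ) :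
    (starRingEnd ℂ) (rippletFourier n μ m ω) = rippletFourier n μ m (-ω) := by
  unfold rippletFourier
  rw [(multipliable_rippletFourier n hn μ m ω).map_tprod (starRingEnd ℂ) Complex.continuous_conj]
  refine tprod_congr fun j => ?_
  simp only [rippletSymbol, map_sum, map_mul, map_pow, Complex.conj_ofReal, ← Complex.exp_conj,
    map_neg, Complex.conj_I]
  refine Finset.sum_congr rfl fun α _ => ?_
  congr 3
  push_cast
  ring

theorem ofReal_ripplet (n : ℕ) (hn : 1 ≤ n) (μ : ℝ) (m : ℕ) (x : ℝ) :
    (ripplet n μ m x : ℂ) = rippletC n μ m x := by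
  unfold ripplet
  refine Complex.conj_eq_iff_re.mp ?_
  unfold rippletC
  rw [map_mul, Complex.conj_ofReal, ← integral_conj]
  congr 1
  rw [← MeasureTheory.integral_neg_eq_self]
  congr 1
  funext ω
  rw [map_mul, conj_rippletFourier n hn, ← Complex.exp_conj, neg_neg]
  simp

open MeasureTheory Filter Topology Set

/-! For `m ≥ 1` the symbol gains a factor `(1 + z) / 2` whenever `n` grows by one
(`rippletSymbol_succ`). Over all scales these factors multiply to the transform of the normalized
box on `[0, 2^(-m)]`, so φ^(n+1,m) is the moving average of φ^(n,m) over a window equal to the shift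
(`rippletFourier_succ_left`, `ripplet_eq_movingAverage`). Differentiating a series of shifted moving
averages takes backward differences of its coefficients. Conversely, if `p'` lies in V^(n,m),
summing coefficients puts `p` in V^(n+1,m) up to a constant; constants are available because the
windows tile the line and φ^(n,m) has mass one (`exists_hasSum_movingAverage`). Induction from the
zero polynomial at `n = 1` gives (a). For (b), φ^(n+1,0) is a moving average of φ^(n,1) over a unit
window, and the tiling alone gives constants.

The analytic input is that, for `m ≥ 1`, φ^(n,m) is continuous, supported in `[0, (n+1)/2^m]` and of
mass one. Continuity comes from integrability of the Fourier transform; there `μ > 1` enters,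
through the summable defects `1 - 2^(-m^(-μ))` (`integrable_rippletFourier_one`). Support and mass
come from pairing with test functions (`integral_mul_rippletC`). -/

/-! ### Factorization of the symbols -/

theorem rippletSymbol_eq (n : ℕ) (hn : 1 ≤ n) (μ : ℝ) (m : ℕ) (hm : 1 ≤ m) (z : ℂ) :
    rippletSymbol n μ m z = ((1 / (2 : ℝ) ^ ((n : ℝ) + 1 + (m : ℝ) ^ (-μ)) : ℝ) : ℂ) *
      ((1 + z) ^ (n + 1) +
        4 * (((2 : ℝ) ^ ((m : ℝ) ^ (-μ)) - 1 : ℝ) : ℂ) * (z * (1 + z) ^ (n - 1))) := by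
  have h1 : (1 + z) ^ (n + 1) = ∑ α ∈ Finset.range (n + 2), ((n + 1).choose α : ℂ) * z ^ α := by
    rw [add_comm, add_pow]
    exact Finset.sum_congr rfl fun α _ => by simp [mul_comm]
  have h2 : z * (1 + z) ^ (n - 1) = ∑ α ∈ Finset.range (n + 2),
      (if α = 0 then 0 else ((n - 1).choose (α - 1) : ℂ)) * z ^ α := by
    rw [Finset.sum_range_succ']
    simp only [Nat.succ_ne_zero, if_false, Nat.add_sub_cancel, if_true, zero_mul, add_zero]
    rw [Finset.sum_range_succ, Nat.choose_eq_zero_of_lt (by omega), add_comm, add_pow,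
      Nat.sub_add_cancel hn, Finset.mul_sum]
    simp only [Nat.cast_zero, zero_mul, add_zero]
    exact Finset.sum_congr rfl fun α _ => by simp only [one_pow, mul_one]; ring
  rw [h1, h2, rippletSymbol, Finset.mul_sum, ← Finset.sum_add_distrib, Finset.mul_sum]
  refine Finset.sum_congr rfl fun α hα => ?_
  rw [Finset.mem_range] at hα
  rw [rippletMask, if_neg (by omega), if_pos (by omega)]
  split_ifs with h <;> push_cast <;> ring

theorem rippletSymbol_succ (n : ℕ) (hn : 1 ≤ n) (μ : ℝ) (m : ℕ) (hm : 1 ≤ m) (z : ℂ) :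
    rippletSymbol (n + 1) μ m z = (1 + z) / 2 * rippletSymbol n μ m z := by
  rw [rippletSymbol_eq n hn μ m hm, rippletSymbol_eq (n + 1) (by omega) μ m hm]
  have h : (2 : ℝ) ^ (((n + 1 : ℕ) : ℝ) + 1 + (m : ℝ) ^ (-μ)) =
      2 * (2 : ℝ) ^ ((n : ℝ) + 1 + (m : ℝ) ^ (-μ)) := by
    rw [show ((n + 1 : ℕ) : ℝ) + 1 + (m : ℝ) ^ (-μ) = 1 + ((n : ℝ) + 1 + (m : ℝ) ^ (-μ)) by
      push_cast; ring, Real.rpow_add two_pos, Real.rpow_one]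
  obtain ⟨k, rfl⟩ := Nat.exists_eq_add_of_le' hn
  rw [h]
  simp only [Nat.add_sub_cancel]
  push_cast
  have h0 : ((2 ^ ((k : ℝ) + 1 + 1 + (m : ℝ) ^ (-μ)) : ℝ) : ℂ) ≠ 0 := by
    exact_mod_cast (Real.rpow_pos_of_pos two_pos _).ne'
  field_simp
  ring

theorem rippletSymbol_zero (n : ℕ) (μ : ℝ) (z : ℂ) :
    rippletSymbol n μ 0 z = (1 + z) / 2 := by
  rw [rippletSymbol, Finset.sum_range_succ', Finset.sum_eq_single 0]
  · simp [rippletMask]; ring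
  · intro b _ hb
    simp [rippletMask, hb]
  · intro h
    simp at h

/-! ### Modulus of the symbol for `n = 1` -/

/-- The amount `1 - 2^{-m^{-μ}}` by which the mask of level `m` deviates from a spline mask. -/
noncomputable def rippletDefect (μ : ℝ) (m : ℕ) : ℝ := 1 - (2 : ℝ) ^ (-(m : ℝ) ^ (-μ))

theorem rippletDefect_nonneg (μ : ℝ) (m : ℕ) : 0 ≤ rippletDefect μ m := by
  unfold rippletDefect
  have : (2 : ℝ) ^ (-(m : ℝ) ^ (-μ)) ≤ 1 :=
    Real.rpow_le_one_of_one_le_of_nonpos (by norm_num) (by simp; positivity)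
  linarith

theorem rippletDefect_le_one (μ : ℝ) (m : ℕ) : rippletDefect μ m ≤ 1 := by
  unfold rippletDefect
  have : 0 < (2 : ℝ) ^ (-(m : ℝ) ^ (-μ)) := Real.rpow_pos_of_pos two_pos _
  linarith

theorem rippletDefect_le (μ : ℝ) (m : ℕ) : rippletDefect μ m ≤ (m : ℝ) ^ (-μ) := by
  unfold rippletDefect
  rw [Real.rpow_def_of_pos two_pos]
  have h1 := Real.add_one_le_exp (Real.log 2 * -(m : ℝ) ^ (-μ))
  have h2 : Real.log 2 ≤ 1 := by linarith [Real.log_two_lt_d9]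
  have h3 : 0 ≤ (m : ℝ) ^ (-μ) := by positivity
  nlinarith

theorem summable_rippletDefect (μ : ℝ) (hμ : 1 < μ) : Summable (rippletDefect μ) :=
  Summable.of_nonneg_of_le (rippletDefect_nonneg μ) (rippletDefect_le μ)
    (Real.summable_nat_rpow.mpr (by linarith))

/-- The modulus of the symbol of level `m` for `n = 1` at `exp (-i θ)`. -/
noncomputable def rippletModulus (μ : ℝ) (m : ℕ) (θ : ℝ) : ℝ :=
  (1 + rippletDefect μ m) / 2 + (1 - rippletDefect μ m) / 2 * Real.cos θ

theorem rippletModulus_nonneg (μ : ℝ) (m : ℕ) (θ : ℝ) : 0 ≤ rippletModulus μ m θ := by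
  unfold rippletModulus
  have := rippletDefect_nonneg μ m
  have := rippletDefect_le_one μ m
  have := Real.neg_one_le_cos θ
  nlinarith

/-- A spline mask would give exactly 1; the excess is the defect, and summable defects keep the
product over all levels bounded. -/
theorem rippletModulus_add_pi (μ : ℝ) (m : ℕ) (θ : ℝ) :
    rippletModulus μ m θ + rippletModulus μ m (θ + Real.pi) = 1 + rippletDefect μ m := by
  unfold rippletModulus
  rw [Real.cos_add_pi]
  ring

theorem rippletModulus_periodic (μ : ℝ) (m : ℕ) :
    Function.Periodic (rippletModulus μ m) (2 * Real.pi) := by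
  intro θ
  simp [rippletModulus]

theorem norm_exp_neg_I_mul (θ : ℝ) : ‖Complex.exp (-Complex.I * (θ : ℝ))‖ = 1 := by
  rw [show -Complex.I * (θ : ℂ) = ((-θ : ℝ) : ℂ) * Complex.I by push_cast; ring,
    Complex.norm_exp_ofReal_mul_I]

/-- For `z = exp (-iθ)`, `(1 + z)^2 = z (2 + 2 cos θ)`, so the symbol is `z` times a nonnegative
trigonometric polynomial. -/
theorem norm_rippletSymbol_one (μ : ℝ) (m : ℕ) (hm : 1 ≤ m) (θ : ℝ) :
    ‖rippletSymbol 1 μ m (Complex.exp (-Complex.I * (θ : ℝ)))‖ = rippletModulus μ m θ := by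
  have key : rippletSymbol 1 μ m (Complex.exp (-Complex.I * (θ : ℝ))) =
      Complex.exp (-Complex.I * (θ : ℝ)) * (rippletModulus μ m θ : ℂ) := by
    rw [rippletSymbol_eq 1 le_rfl μ m hm, rippletModulus, rippletDefect]
    have hc : (1 + Complex.exp (-Complex.I * θ)) ^ 2 =
        Complex.exp (-Complex.I * θ) * (2 + 2 * Complex.cos θ) := by
      have h1 : Complex.exp (-Complex.I * θ) * Complex.exp (θ * Complex.I) = 1 := by
        rw [← Complex.exp_add]; ring_nf; simp
      rw [Complex.cos, show -(θ : ℂ) * Complex.I = -Complex.I * θ by ring]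
      linear_combination -h1
    set ε := (m : ℝ) ^ (-μ)
    have h2 : (2 : ℝ) ^ (((1 : ℕ) : ℝ) + 1 + ε) = 4 * 2 ^ ε := by
      rw [Real.rpow_add two_pos]; norm_num
    have h0 : (((2 : ℝ) ^ ε : ℝ) : ℂ) ≠ 0 := by
      exact_mod_cast (Real.rpow_pos_of_pos two_pos _).ne'
    rw [h2, hc, Real.rpow_neg two_pos.le]
    generalize (2 : ℝ) ^ ε = t at *
    push_cast
    simp only [pow_zero, mul_one]
    field_simp
    ring
  rw [key, norm_mul, norm_exp_neg_I_mul, one_mul, Complex.norm_real,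
    Real.norm_of_nonneg (rippletModulus_nonneg μ m θ)]

theorem norm_rippletSymbol_le_one (n : ℕ) (hn : 1 ≤ n) (μ : ℝ) (m : ℕ) (θ : ℝ) :
    ‖rippletSymbol n μ m (Complex.exp (-Complex.I * (θ : ℝ)))‖ ≤ 1 := by
  rw [← sum_rippletMask n hn μ m, rippletSymbol]
  refine (norm_sum_le _ _).trans (Finset.sum_le_sum fun α _ => ?_)
  rw [norm_mul, norm_pow, norm_exp_neg_I_mul, one_pow, mul_one, Complex.norm_real,
    Real.norm_of_nonneg (rippletMask_nonneg n μ m α)]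

theorem continuous_rippletSymbol_exp (n : ℕ) (μ : ℝ) (m k : ℕ) :
    Continuous fun ω : ℝ =>
      rippletSymbol n μ m (Complex.exp (-Complex.I * (ω / 2 ^ k : ℝ))) := by
  unfold rippletSymbol
  fun_prop

/-! ### Partial products and integrability of the Fourier transform -/

/-- The partial products of `rippletFourier`. -/
noncomputable def rippletPartial (n : ℕ) (μ : ℝ) (m J : ℕ) (ω : ℝ) : ℂ :=
  ∏ j ∈ Finset.range J,
    rippletSymbol n μ (m + j) (Complex.exp (-Complex.I * (ω / 2 ^ (m + j + 1) : ℝ)))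

theorem continuous_rippletPartial (n : ℕ) (μ : ℝ) (m J : ℕ) :
    Continuous (rippletPartial n μ m J) :=
  continuous_finsetProd _ fun j _ => continuous_rippletSymbol_exp n μ (m + j) (m + j + 1)

theorem norm_rippletPartial_le_one (n : ℕ) (hn : 1 ≤ n) (μ : ℝ) (m J : ℕ) (ω : ℝ) :
    ‖rippletPartial n μ m J ω‖ ≤ 1 := by
  rw [rippletPartial, norm_prod]
  exact Finset.prod_le_one (fun _ _ => norm_nonneg _)
    fun j _ => norm_rippletSymbol_le_one n hn μ _ _

theorem tendsto_rippletPartial (n : ℕ) (hn : 1 ≤ n) (μ : ℝ) (m : ℕ) (ω : ℝ) :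
    Tendsto (fun J => rippletPartial n μ m J ω) atTop (𝓝 (rippletFourier n μ m ω)) :=
  (multipliable_rippletFourier n hn μ m ω).hasProd.tendsto_prod_nat

theorem rippletPartial_succ' (n : ℕ) (μ : ℝ) (m J : ℕ) (ω : ℝ) :
    rippletPartial n μ m (J + 1) ω =
      rippletSymbol n μ m (Complex.exp (-Complex.I * (ω / 2 ^ (m + 1) : ℝ))) *
        rippletPartial n μ (m + 1) J ω := by
  rw [rippletPartial, Finset.prod_range_succ', mul_comm]
  congr 1
  refine Finset.prod_congr rfl fun j _ => ?_
  rw [show m + (j + 1) = m + 1 + j by ring]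

theorem norm_rippletFourier_le_one (n : ℕ) (hn : 1 ≤ n) (μ : ℝ) (m : ℕ) (ω : ℝ) :
    ‖rippletFourier n μ m ω‖ ≤ 1 :=
  le_of_tendsto (tendsto_rippletPartial n hn μ m ω).norm
    (Eventually.of_forall fun J => norm_rippletPartial_le_one n hn μ m J ω)

theorem rippletFourier_eq_rippletPartial_mul (n : ℕ) (hn : 1 ≤ n) (μ : ℝ) (m J : ℕ) (ω : ℝ) :
    rippletFourier n μ m ω = rippletPartial n μ m J ω * rippletFourier n μ (m + J) ω := by
  induction J generalizing m with
  | zero => simp [rippletPartial]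
  | succ J ih =>
    rw [rippletFourier_succ n hn, ih (m + 1), rippletPartial_succ', mul_assoc,
      show m + 1 + J = m + (J + 1) by ring]

theorem stronglyMeasurable_rippletFourier (n : ℕ) (hn : 1 ≤ n) (μ : ℝ) (m : ℕ) :
    StronglyMeasurable (rippletFourier n μ m) :=
  stronglyMeasurable_of_tendsto atTop
    (fun J => (continuous_rippletPartial n μ m J).stronglyMeasurable)
    (tendsto_pi_nhds.mpr (tendsto_rippletPartial n hn μ m))

/-- Each new factor doubles the period. Moving by the old period `T` turns the angle of the new
factor by π, so folding the two halves together multiplies the integral by `1 + rippletDefect`. -/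
theorem integral_norm_rippletPartial (μ : ℝ) (m : ℕ) (hm : 1 ≤ m) (J : ℕ) :
    Function.Periodic (fun ω => ‖rippletPartial 1 μ m J ω‖) (2 * Real.pi * 2 ^ (m + J)) ∧
    ∫ ω in (0 : ℝ)..2 * Real.pi * 2 ^ (m + J), ‖rippletPartial 1 μ m J ω‖ =
      2 * Real.pi * 2 ^ m * ∏ j ∈ Finset.range J, (1 + rippletDefect μ (m + j)) := by
  induction J with
  | zero => simp [rippletPartial, Function.Periodic]
  | succ J ih =>
    obtain ⟨hp, hi⟩ := ih
    set T : ℝ := 2 * Real.pi * 2 ^ (m + J) with hT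
    have hT2 : 2 * Real.pi * 2 ^ (m + (J + 1)) = T + T := by rw [hT]; ring
    have hs : ∀ ω, ‖rippletPartial 1 μ m (J + 1) ω‖ =
        ‖rippletPartial 1 μ m J ω‖ * rippletModulus μ (m + J) (ω / 2 ^ (m + J + 1)) := by
      intro ω
      rw [rippletPartial, Finset.prod_range_succ, norm_mul,
        norm_rippletSymbol_one μ _ (by omega)]
      rfl
    have hshift : ∀ ω : ℝ, (ω + T) / 2 ^ (m + J + 1) = ω / 2 ^ (m + J + 1) + Real.pi := by
      intro ω
      rw [hT]
      field_simp
      ring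
    have hc : ∀ J, Continuous fun ω => ‖rippletPartial 1 μ m J ω‖ :=
      fun J => (continuous_rippletPartial 1 μ m J).norm
    rw [hT2]
    constructor
    · intro ω
      simp only [hs]
      have hp' : ∀ ω, ‖rippletPartial 1 μ m J (ω + T)‖ = ‖rippletPartial 1 μ m J ω‖ := hp
      rw [← add_assoc, hp', hp', hshift, hshift, add_assoc, ← two_mul, rippletModulus_periodic]
    · rw [← intervalIntegral.integral_add_adjacent_intervals (b := T)
        ((hc _).intervalIntegrable _ _) ((hc _).intervalIntegrable _ _)]
      have h2 : ∫ ω in T..T + T, ‖rippletPartial 1 μ m (J + 1) ω‖ =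
          ∫ ω in (0 : ℝ)..T, ‖rippletPartial 1 μ m (J + 1) (ω + T)‖ := by
        rw [intervalIntegral.integral_comp_add_right
          (fun ω => ‖rippletPartial 1 μ m (J + 1) ω‖), zero_add]
      have hp' : ∀ ω, ‖rippletPartial 1 μ m J (ω + T)‖ = ‖rippletPartial 1 μ m J ω‖ := hp
      have hcT : Continuous fun ω => ‖rippletPartial 1 μ m (J + 1) (ω + T)‖ :=
        (hc (J + 1)).comp (continuous_add_const T)
      rw [h2, ← intervalIntegral.integral_add ((hc _).intervalIntegrable _ _)
        (hcT.intervalIntegrable _ _)]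
      have h3 : ∀ ω, ‖rippletPartial 1 μ m (J + 1) ω‖ + ‖rippletPartial 1 μ m (J + 1) (ω + T)‖ =
          ‖rippletPartial 1 μ m J ω‖ * (1 + rippletDefect μ (m + J)) := by
        intro ω
        rw [hs, hs, hp', hshift, ← mul_add, rippletModulus_add_pi]
      simp only [h3]
      rw [intervalIntegral.integral_mul_const, hi, Finset.prod_range_succ]
      ring

theorem integrable_rippletFourier_one (μ : ℝ) (hμ : 1 < μ) (m : ℕ) (hm : 1 ≤ m) :
    Integrable (rippletFourier 1 μ m) := by
  have hpow : Tendsto (fun J : ℕ => Real.pi * (2 : ℝ) ^ (m + J)) atTop atTop := by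
    have h := tendsto_pow_atTop_atTop_of_one_lt (r := (2 : ℝ)) (by norm_num)
    refine Tendsto.const_mul_atTop Real.pi_pos (h.comp ?_)
    exact tendsto_atTop_mono (fun J => Nat.le_add_left J m) tendsto_id
  have hb : ∀ a b : ℝ, IntegrableOn (rippletFourier 1 μ m) (Ioc a b) := fun a b =>
    Measure.integrableOn_of_bounded (M := 1) (by simp)
      (stronglyMeasurable_rippletFourier 1 le_rfl μ m).aestronglyMeasurable
      (Eventually.of_forall fun ω => norm_rippletFourier_le_one 1 le_rfl μ m ω)
  -- Each interval is one full period of the partial product with `J` factors, which dominates the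
  -- infinite product because the remaining factors have modulus at most one.
  refine integrable_of_intervalIntegral_norm_bounded
    (2 * Real.pi * 2 ^ m * Real.exp (∑' k, rippletDefect μ k))
    (a := fun J : ℕ => -(Real.pi * (2 : ℝ) ^ (m + J)))
    (b := fun J : ℕ => Real.pi * (2 : ℝ) ^ (m + J)) (fun J => hb _ _)
    (tendsto_neg_atTop_atBot.comp hpow) hpow (Eventually.of_forall fun J => ?_)
  have hpos : 0 ≤ Real.pi * (2 : ℝ) ^ (m + J) := by positivity
  have hle : -(Real.pi * (2 : ℝ) ^ (m + J)) ≤ Real.pi * (2 : ℝ) ^ (m + J) := by linarith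
  obtain ⟨hp, hi⟩ := integral_norm_rippletPartial μ m hm J
  calc ∫ ω in -(Real.pi * (2 : ℝ) ^ (m + J))..Real.pi * (2 : ℝ) ^ (m + J),
        ‖rippletFourier 1 μ m ω‖
      ≤ ∫ ω in -(Real.pi * (2 : ℝ) ^ (m + J))..Real.pi * (2 : ℝ) ^ (m + J),
        ‖rippletPartial 1 μ m J ω‖ := by
        refine intervalIntegral.integral_mono_on hle ?_
          ((continuous_rippletPartial 1 μ m J).norm.intervalIntegrable _ _) fun ω _ => ?_
        · rw [intervalIntegrable_iff_integrableOn_Ioc_of_le hle]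
          exact (hb _ _).norm
        · rw [rippletFourier_eq_rippletPartial_mul 1 le_rfl μ m J, norm_mul]
          exact mul_le_of_le_one_right (norm_nonneg _)
            (norm_rippletFourier_le_one 1 le_rfl μ _ ω)
    _ = 2 * Real.pi * 2 ^ m * ∏ j ∈ Finset.range J, (1 + rippletDefect μ (m + j)) := by
        rw [← hi]
        have := hp.intervalIntegral_add_eq (-(Real.pi * (2 : ℝ) ^ (m + J))) 0
        rw [zero_add] at this
        rw [← this]
        congr 1
        ring
    _ ≤ _ := by
        gcongr
        calc ∏ j ∈ Finset.range J, (1 + rippletDefect μ (m + j))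
            ≤ ∏ j ∈ Finset.range J, Real.exp (rippletDefect μ (m + j)) := by
              refine Finset.prod_le_prod
                (fun j _ => by linarith [rippletDefect_nonneg μ (m + j)]) fun j _ => ?_
              rw [add_comm]
              exact Real.add_one_le_exp _
          _ = Real.exp (∑ j ∈ Finset.range J, rippletDefect μ (m + j)) := (Real.exp_sum _ _).symm
          _ ≤ _ := by
              refine Real.exp_le_exp.mpr ?_
              rw [← Finset.sum_image (f := rippletDefect μ) (g := fun j => m + j)
                (fun a _ b _ h => by simpa using h)]
              exact (summable_rippletDefect μ hμ).sum_le_tsum _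
                fun k _ => rippletDefect_nonneg μ k

/-! ### The box factor -/

theorem exp_neg_I_mul_ofReal_add (a b : ℝ) :
    Complex.exp (-Complex.I * (a + b : ℝ)) =
      Complex.exp (-Complex.I * (a : ℝ)) * Complex.exp (-Complex.I * (b : ℝ)) := by
  rw [← Complex.exp_add]
  push_cast
  ring_nf

/-- The Fourier transform of the normalized indicator function of `[0, 1 / q]`. -/
noncomputable def boxFourier (q ω : ℝ) : ℂ :=
  q * ∫ t in (0 : ℝ)..1 / q, Complex.exp (-Complex.I * (ω * t : ℝ))

/-- The box is the average of two boxes of half its width, one of them shifted by `1 / (2q)`. -/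
theorem boxFourier_two_mul {q : ℝ} (hq : 0 < q) (ω : ℝ) :
    boxFourier q ω = (1 + Complex.exp (-Complex.I * (ω / (2 * q) : ℝ))) / 2 *
      boxFourier (2 * q) ω := by
  have hc : Continuous fun t : ℝ => Complex.exp (-Complex.I * (ω * t : ℝ)) := by fun_prop
  have h : ∫ t in 1 / (2 * q)..1 / q, Complex.exp (-Complex.I * (ω * t : ℝ)) =
      Complex.exp (-Complex.I * (ω / (2 * q) : ℝ)) *
        ∫ t in (0 : ℝ)..1 / (2 * q), Complex.exp (-Complex.I * (ω * t : ℝ)) := by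
    rw [← intervalIntegral.integral_const_mul]
    have h1 : ∀ t : ℝ, Complex.exp (-Complex.I * (ω / (2 * q) : ℝ)) *
        Complex.exp (-Complex.I * (ω * t : ℝ)) =
        Complex.exp (-Complex.I * (ω * (t + 1 / (2 * q)) : ℝ)) := by
      intro t
      rw [← exp_neg_I_mul_ofReal_add]
      ring_nf
    simp only [h1]
    rw [intervalIntegral.integral_comp_add_right
      (fun t : ℝ => Complex.exp (-Complex.I * (ω * t : ℝ)))]
    congr 1
    · ring
    · field_simp
      norm_num
  rw [boxFourier, boxFourier, ← intervalIntegral.integral_add_adjacent_intervals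
    (b := 1 / (2 * q)) (hc.intervalIntegrable _ _) (hc.intervalIntegrable _ _), h]
  push_cast
  ring

theorem norm_boxFourier_sub_one_le {q : ℝ} (hq : 0 < q) (ω : ℝ) :
    ‖boxFourier q ω - 1‖ ≤ |ω| / q := by
  have hc : Continuous fun t : ℝ => Complex.exp (-Complex.I * (ω * t : ℝ)) := by fun_prop
  have hq' : (q : ℂ) ≠ 0 := by exact_mod_cast hq.ne'
  have h : boxFourier q ω - 1 =
      q * ∫ t in (0 : ℝ)..1 / q, (Complex.exp (-Complex.I * (ω * t : ℝ)) - 1) := by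
    rw [intervalIntegral.integral_sub (hc.intervalIntegrable _ _) (by simp), boxFourier]
    simp [mul_sub, hq']
  have hb := intervalIntegral.norm_integral_le_of_norm_le_const (a := 0) (b := 1 / q)
    (f := fun t : ℝ => Complex.exp (-Complex.I * (ω * t : ℝ)) - 1) (C := |ω| / q) (by
      intro t ht
      rw [uIoc_of_le (by positivity)] at ht
      have := Real.norm_exp_I_mul_ofReal_sub_one_le (x := -(ω * t))
      rw [show Complex.I * ((-(ω * t) : ℝ) : ℂ) = -Complex.I * (ω * t : ℝ) by push_cast; ring]
        at this
      refine this.trans ?_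
      rw [Real.norm_eq_abs, abs_neg, abs_mul, abs_of_pos ht.1, div_eq_mul_one_div]
      gcongr
      exact ht.2)
  rw [h, norm_mul, Complex.norm_real, Real.norm_of_nonneg hq.le]
  refine (mul_le_mul_of_nonneg_left hb hq.le).trans ?_
  rw [sub_zero, abs_of_pos (show 0 < 1 / q by positivity)]
  field_simp
  exact le_rfl

theorem tendsto_boxFourier (m : ℕ) (ω : ℝ) :
    Tendsto (fun J : ℕ => boxFourier (2 ^ (m + J)) ω) atTop (𝓝 1) := by
  rw [tendsto_iff_norm_sub_tendsto_zero]
  refine squeeze_zero (fun _ => norm_nonneg _)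
    (fun J => norm_boxFourier_sub_one_le (by positivity) ω) ?_
  have h := tendsto_pow_atTop_atTop_of_one_lt (r := (2 : ℝ)) (by norm_num)
  exact tendsto_const_nhds.div_atTop
    (h.comp (tendsto_atTop_mono (fun J => Nat.le_add_left J m) tendsto_id))

/-- The identity telescopes: a partial product for `n + 1`, times the box at the finest scale
reached, is the coarse box times the partial product for `n`. The fine box tends to one. -/
theorem rippletFourier_succ_left (n : ℕ) (hn : 1 ≤ n) (μ : ℝ) (m : ℕ) (hm : 1 ≤ m) (ω : ℝ) :
    rippletFourier (n + 1) μ m ω = boxFourier (2 ^ m) ω * rippletFourier n μ m ω := by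
  have h : ∀ J, rippletPartial (n + 1) μ m J ω * boxFourier (2 ^ (m + J)) ω =
      boxFourier (2 ^ m) ω * rippletPartial n μ m J ω := by
    intro J
    induction J with
    | zero => simp [rippletPartial]
    | succ J ih =>
      rw [rippletPartial, rippletPartial, Finset.prod_range_succ, Finset.prod_range_succ,
        ← rippletPartial, ← rippletPartial, rippletSymbol_succ n hn μ _ (by omega),
        ← mul_assoc (boxFourier (2 ^ m) ω), ← ih, boxFourier_two_mul (q := 2 ^ (m + J)) (by positivity),
        show (2 : ℝ) * 2 ^ (m + J) = 2 ^ (m + J + 1) by ring, ← add_assoc]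
      ring
  have h1 := (tendsto_rippletPartial (n + 1) (by omega) μ m ω).mul (tendsto_boxFourier m ω)
  simp only [h, mul_one] at h1
  exact tendsto_nhds_unique h1 ((tendsto_rippletPartial n hn μ m ω).const_mul _)

theorem rippletFourier_level_zero (n : ℕ) (hn : 1 ≤ n) (μ : ℝ) (ω : ℝ) :
    rippletFourier (n + 1) μ 0 ω = boxFourier 1 ω * rippletFourier n μ 1 ω := by
  rw [rippletFourier_succ (n + 1) (by omega), zero_add,
    rippletFourier_succ_left n hn μ 1 le_rfl, rippletSymbol_zero,
    boxFourier_two_mul one_pos]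
  simp only [pow_one, mul_one, mul_assoc]

theorem continuous_boxFourier (q : ℝ) : Continuous (boxFourier q) := by
  unfold boxFourier
  refine continuous_const.mul ?_
  exact intervalIntegral.continuous_parametric_intervalIntegral_of_continuous'
    (f := fun ω t : ℝ => Complex.exp (-Complex.I * (ω * t : ℝ))) (by fun_prop) _ _

theorem norm_boxFourier_le_one {q : ℝ} (hq : 0 < q) (ω : ℝ) : ‖boxFourier q ω‖ ≤ 1 := by
  have hb := intervalIntegral.norm_integral_le_of_norm_le_const (a := 0) (b := 1 / q)
    (f := fun t : ℝ => Complex.exp (-Complex.I * (ω * t : ℝ))) (C := 1)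
    (fun t _ => (norm_exp_neg_I_mul _).le)
  rw [boxFourier, norm_mul, Complex.norm_real, Real.norm_of_nonneg hq.le]
  refine (mul_le_mul_of_nonneg_left hb hq.le).trans ?_
  rw [sub_zero, abs_of_pos (show 0 < 1 / q by positivity), one_mul, mul_one_div_cancel hq.ne']

theorem integrable_rippletFourier (n : ℕ) (hn : 1 ≤ n) (μ : ℝ) (hμ : 1 < μ) (m : ℕ)
    (hm : 1 ≤ m) : Integrable (rippletFourier n μ m) := by
  induction n, hn using Nat.le_induction with
  | base => exact integrable_rippletFourier_one μ hμ m hm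
  | succ n hn ih =>
    rw [show rippletFourier (n + 1) μ m = fun ω => boxFourier (2 ^ m) ω * rippletFourier n μ m ω
      from funext (rippletFourier_succ_left n hn μ m hm)]
    exact ih.bdd_mul (c := 1) (continuous_boxFourier _).aestronglyMeasurable
      (Eventually.of_forall fun ω => norm_boxFourier_le_one (by positivity) ω)

/-! ### Inverse transforms and pairing with test functions -/

/-- The inverse Fourier transform, in the normalization of `rippletC`. -/
noncomputable def angularFourierInv (F : ℝ → ℂ) (x : ℝ) : ℂ :=
  (1 / (2 * Real.pi) : ℝ) * ∫ ω : ℝ, Complex.exp (Complex.I * (ω * x : ℝ)) * F ω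

theorem norm_exp_I_mul (θ : ℝ) : ‖Complex.exp (Complex.I * (θ : ℝ))‖ = 1 := by
  rw [mul_comm, Complex.norm_exp_ofReal_mul_I]

theorem continuous_angularFourierInv {F : ℝ → ℂ} (hF : Integrable F) :
    Continuous (angularFourierInv F) := by
  refine continuous_const.mul (continuous_of_dominated (bound := fun ω => ‖F ω‖) ?_ ?_ hF.norm ?_)
  · intro x
    exact (Continuous.aestronglyMeasurable (by fun_prop)).mul hF.aestronglyMeasurable
  · intro x
    exact Eventually.of_forall fun ω => by rw [norm_mul, norm_exp_I_mul, one_mul]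
  · exact Eventually.of_forall fun ω => by fun_prop

theorem angularFourierInv_boxFourier_mul (q : ℝ) {F : ℝ → ℂ} (hF : Integrable F)
    (x : ℝ) : angularFourierInv (fun ω => boxFourier q ω * F ω) x =
      q * ∫ t in (x - 1 / q)..x, angularFourierInv F t := by
  have hint : Integrable (Function.uncurry fun t ω : ℝ =>
      Complex.exp (Complex.I * (ω * (x - t) : ℝ)) * F ω)
      ((volume.restrict (uIoc 0 (1 / q))).prod volume) := by
    have h1 : Integrable (fun p : ℝ × ℝ => F p.2)
        ((volume.restrict (uIoc 0 (1 / q))).prod volume) := by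
      have : IsFiniteMeasure (volume.restrict (uIoc 0 (1 / q))) :=
        ⟨by rw [Measure.restrict_apply_univ, uIoc]; exact measure_Ioc_lt_top⟩
      exact hF.comp_snd _
    refine h1.bdd_mul (c := 1) (Continuous.aestronglyMeasurable (by fun_prop))
      (Eventually.of_forall fun p => (norm_exp_I_mul _).le)
  have hx : ∫ t in (x - 1 / q)..x, angularFourierInv F t =
      ∫ t in (0 : ℝ)..1 / q, angularFourierInv F (x - t) := by
    rw [intervalIntegral.integral_comp_sub_left, sub_zero]
  rw [hx]
  unfold angularFourierInv
  rw [intervalIntegral.integral_const_mul, intervalIntegral_integral_swap hint, mul_left_comm,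
    ← integral_const_mul (q : ℂ)]
  congr 2
  funext ω
  rw [intervalIntegral.integral_mul_const]
  simp only [boxFourier]
  have h2 : ∫ t in (0 : ℝ)..1 / q, Complex.exp (Complex.I * (ω * (x - t) : ℝ)) =
      Complex.exp (Complex.I * (ω * x : ℝ)) *
        ∫ t in (0 : ℝ)..1 / q, Complex.exp (-Complex.I * (ω * t : ℝ)) := by
    rw [← intervalIntegral.integral_const_mul]
    congr 1
    funext t
    rw [← Complex.exp_add]
    push_cast
    ring_nf
  rw [h2]
  ring

/-- Dually, the partial product is the transform of a probability measure on `[0, (n+1)/2^m]`.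
Splitting off one symbol averages translates by `α / 2^(m+1)`, `α ≤ n + 1`, of a measure on the
interval of half the length. -/
theorem integral_rippletPartial_mul (n : ℕ) (hn : 1 ≤ n) (μ : ℝ) (m J : ℕ) {G : ℝ → ℂ}
    (hG : Integrable G) {c : ℂ} (h : ∀ y ∈ Icc (0 : ℝ) ((n + 1) / 2 ^ m),
      ∫ ω : ℝ, Complex.exp (-Complex.I * (ω * y : ℝ)) * G ω = c) :
    ∫ ω, rippletPartial n μ m J ω * G ω = c := by
  induction J generalizing m G with
  | zero =>
    have := h 0 ⟨le_rfl, by positivity⟩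
    simpa [rippletPartial] using this
  | succ J ih =>
    have hG' : ∀ y : ℝ, Integrable fun ω : ℝ =>
        Complex.exp (-Complex.I * (ω * y : ℝ)) * G ω := fun y =>
      hG.bdd_mul (c := 1) (Continuous.aestronglyMeasurable (by fun_prop))
        (Eventually.of_forall fun p => (norm_exp_neg_I_mul _).le)
    have h1 : ∀ ω, rippletPartial n μ m (J + 1) ω * G ω =
        ∑ α ∈ Finset.range (n + 2), (rippletMask n μ m α : ℂ) * (rippletPartial n μ (m + 1) J ω *
          (Complex.exp (-Complex.I * (ω * (α / 2 ^ (m + 1)) : ℝ)) * G ω)) := by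
      intro ω
      rw [rippletPartial_succ', rippletSymbol, mul_assoc, Finset.sum_mul]
      refine Finset.sum_congr rfl fun α _ => ?_
      rw [← Complex.exp_nat_mul]
      have : (α : ℂ) * (-Complex.I * (ω / 2 ^ (m + 1) : ℝ)) =
          -Complex.I * (ω * (α / 2 ^ (m + 1)) : ℝ) := by
        push_cast; ring
      rw [this]
      ring
    simp only [h1]
    rw [integral_finsetSum]
    · have h2 : ∀ α ∈ Finset.range (n + 2), ∫ ω, (rippletMask n μ m α : ℂ) *
          (rippletPartial n μ (m + 1) J ω *
            (Complex.exp (-Complex.I * (ω * (α / 2 ^ (m + 1)) : ℝ)) * G ω)) =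
          (rippletMask n μ m α : ℂ) * c := by
        intro α hα
        rw [integral_const_mul, ih (m + 1) (hG' _)]
        intro y hy
        rw [← h (y + α / 2 ^ (m + 1))]
        · congr 1
          funext ω
          rw [← mul_assoc, ← exp_neg_I_mul_ofReal_add, mul_add]
        · have hα' : (α : ℝ) ≤ n + 1 := by
            rw [Finset.mem_range] at hα
            exact_mod_cast (by omega : α ≤ n + 1)
          refine ⟨add_nonneg hy.1 (by positivity), ?_⟩
          calc y + α / 2 ^ (m + 1) ≤ (n + 1) / 2 ^ (m + 1) + (n + 1) / 2 ^ (m + 1) := by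
                gcongr
                exact hy.2
            _ = _ := by rw [pow_succ]; field_simp; ring
      rw [Finset.sum_congr rfl h2, ← Finset.sum_mul]
      have := sum_rippletMask n hn μ m
      rw [← Complex.ofReal_sum, this, Complex.ofReal_one, one_mul]
    · intro α _
      exact ((hG' _).bdd_mul (c := 1) (continuous_rippletPartial n μ (m + 1) J).aestronglyMeasurable
        (Eventually.of_forall fun ω => norm_rippletPartial_le_one n hn μ _ _ ω)).const_mul _

/-- A single statement serves two ends: `c = 0` yields the support, `c = 1` the total mass. The
proof moves the pairing to the Fourier side and passes to the limit in the partial products. -/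
theorem integral_mul_rippletC (n : ℕ) (hn : 1 ≤ n) (μ : ℝ) (hμ : 1 < μ) (m : ℕ) (hm : 1 ≤ m)
    {g : ℝ → ℝ} (hg : ContDiff ℝ (⊤ : ℕ∞) g) (hgc : HasCompactSupport g) {c : ℝ}
    (h : ∀ y ∈ Icc (0 : ℝ) ((n + 1) / 2 ^ m), g y = c) :
    ∫ x, (g x : ℂ) * rippletC n μ m x = c := by
  have hgC : HasCompactSupport fun x => (g x : ℂ) := hgc.comp_left (g := fun y : ℝ => (y : ℂ)) rfl
  let S : SchwartzMap ℝ ℂ := hgC.toSchwartzMap (Complex.ofRealCLM.contDiff.comp hg)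
  have hS : ∀ x, S x = (g x : ℂ) := fun x => rfl
  have hF := integrable_rippletFourier n hn μ hμ m hm
  have hSi : Integrable fun x => (g x : ℂ) := S.integrable
  set G : ℝ → ℂ := angularFourierInv fun x => (g x : ℂ) with hGdef
  -- The library transform has `2π` in the exponent, hence the rescaling.
  have hGS : ∀ ω, G ω = (1 / (2 * Real.pi) : ℝ) *
      (FourierTransformInv.fourierInv S) (ω / (2 * Real.pi)) := by
    intro ω
    rw [SchwartzMap.fourierInv_coe, Real.fourierInv_eq', hGdef, angularFourierInv]
    congr 2
    funext x
    rw [hS, smul_eq_mul]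
    congr 2
    simp only [RCLike.inner_apply, conj_trivial]
    push_cast
    field_simp
  have hGi : Integrable G := by
    rw [show G = _ from funext hGS]
    exact ((FourierTransformInv.fourierInv S).integrable.comp_div (by positivity)).const_mul _
  have hGinv : ∀ y : ℝ, ∫ ω : ℝ, Complex.exp (-Complex.I * (ω * y : ℝ)) * G ω = g y := by
    intro y
    have h1 : FourierTransform.fourier (FourierTransformInv.fourierInv S) y = S y := by
      rw [FourierTransform.fourier_fourierInv_eq]
    rw [SchwartzMap.fourier_coe, Real.fourier_eq'] at h1
    rw [← hS, ← h1]
    have h2 := Measure.integral_comp_div (fun v : ℝ =>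
      Complex.exp (((-2 * Real.pi * inner ℝ v y : ℝ) : ℂ) * Complex.I) •
        (FourierTransformInv.fourierInv S) v) (2 * Real.pi)
    rw [abs_of_pos (by positivity)] at h2
    rw [← one_smul ℝ (∫ v : ℝ, _ • _), ← one_div_mul_cancel (a := 2 * Real.pi) (by positivity),
      mul_smul, ← h2, ← integral_smul]
    congr 1
    funext ω
    rw [hGS, smul_eq_mul, Complex.real_smul]
    have : -Complex.I * (ω * y : ℝ) =
        ((-2 * Real.pi * inner ℝ (ω / (2 * Real.pi)) y : ℝ) : ℂ) * Complex.I := by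
      simp only [RCLike.inner_apply, conj_trivial]
      push_cast
      field_simp
    rw [this]
    ring
  have hpart : ∀ J, ∫ ω, rippletPartial n μ m J ω * G ω = c := fun J =>
    integral_rippletPartial_mul n hn μ m J hGi fun y hy => by rw [hGinv, h y hy]
  have hlim : Tendsto (fun J => ∫ ω, rippletPartial n μ m J ω * G ω) atTop
      (𝓝 (∫ ω, rippletFourier n μ m ω * G ω)) := by
    refine tendsto_integral_of_dominated_convergence (fun ω => ‖G ω‖)
      (fun J => (continuous_rippletPartial n μ m J).aestronglyMeasurable.mul
        hGi.aestronglyMeasurable) hGi.norm (fun J => Eventually.of_forall fun ω => ?_)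
      (Eventually.of_forall fun ω => (tendsto_rippletPartial n hn μ m ω).mul_const _)
    rw [norm_mul]
    exact mul_le_of_le_one_left (norm_nonneg _) (norm_rippletPartial_le_one n hn μ m J ω)
  simp only [hpart] at hlim
  rw [tendsto_nhds_unique tendsto_const_nhds hlim]
  have hprod : Integrable (Function.uncurry fun x ω : ℝ =>
      Complex.exp (Complex.I * (ω * x : ℝ)) * ((g x : ℂ) * rippletFourier n μ m ω))
      (volume.prod volume) :=
    (hSi.mul_prod hF).bdd_mul (c := 1) (Continuous.aestronglyMeasurable (by fun_prop))
      (Eventually.of_forall fun p => (norm_exp_I_mul _).le)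
  calc ∫ x, (g x : ℂ) * rippletC n μ m x
      = (1 / (2 * Real.pi) : ℝ) * ∫ x, ∫ ω : ℝ,
        Complex.exp (Complex.I * (ω * x : ℝ)) * ((g x : ℂ) * rippletFourier n μ m ω) := by
        rw [← integral_const_mul]
        congr 1
        funext x
        rw [rippletC, mul_left_comm, ← integral_const_mul (g x : ℂ)]
        congr 2
        funext ω
        ring
    _ = ∫ ω, rippletFourier n μ m ω * G ω := by
        rw [integral_integral_swap hprod, ← integral_const_mul]
        congr 1
        funext ω
        rw [hGdef, angularFourierInv, mul_left_comm, ← integral_const_mul (rippletFourier n μ m ω)]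
        congr 2
        funext x
        rw [mul_comm ω x]
        ring

/-! ### Series of translates of a moving average -/

theorem exists_int_backward_difference (b : ℤ → ℝ) :
    ∃ γ : ℤ → ℝ, ∀ α, γ α - γ (α - 1) = b α := by
  refine ⟨fun α => ∑ i ∈ Finset.Ioc 0 α, b i - ∑ i ∈ Finset.Ioc α 0, b i, fun α => ?_⟩
  rcases lt_or_ge 0 α with h | h
  · have h1 : Finset.Ioc 0 α = insert α (Finset.Ioc 0 (α - 1)) := by
      ext i; simp only [Finset.mem_insert, Finset.mem_Ioc]; omega
    have h2 : Finset.Ioc α 0 = ∅ := Finset.Ioc_eq_empty (by omega)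
    have h3 : Finset.Ioc (α - 1) 0 = ∅ := Finset.Ioc_eq_empty (by omega)
    simp only [h1, h2, h3]
    rw [Finset.sum_insert (by simp)]
    simp
  · have h1 : Finset.Ioc (α - 1) 0 = insert α (Finset.Ioc α 0) := by
      ext i; simp only [Finset.mem_insert, Finset.mem_Ioc]; omega
    have h2 : Finset.Ioc 0 α = ∅ := Finset.Ioc_eq_empty (by omega)
    have h3 : Finset.Ioc 0 (α - 1) = ∅ := Finset.Ioc_eq_empty (by omega)
    simp only [h1, h2, h3]
    rw [Finset.sum_insert (by simp)]
    simp

/-- The moving average of `f` over a window of length `1 / q`. -/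
noncomputable def movingAverage (q : ℝ) (f : ℝ → ℝ) (x : ℝ) : ℝ := q * ∫ t in (x - 1 / q)..x, f t

theorem hasDerivAt_movingAverage (q : ℝ) {f : ℝ → ℝ} (hf : Continuous f) (x : ℝ) :
    HasDerivAt (movingAverage q f) (q * (f x - f (x - 1 / q))) x := by
  have h1 : ∀ y, HasDerivAt (fun y => ∫ t in (0 : ℝ)..y, f t) (f y) y := fun y =>
    intervalIntegral.integral_hasDerivAt_right (hf.intervalIntegrable _ _)
      hf.stronglyMeasurable.stronglyMeasurableAtFilter hf.continuousAt
  have h2 : movingAverage q f =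
      fun x => q * ((∫ t in (0 : ℝ)..x, f t) - ∫ t in (0 : ℝ)..(x - 1 / q), f t) := by
    funext x
    rw [movingAverage, intervalIntegral.integral_interval_sub_left (hf.intervalIntegrable _ _)
      (hf.intervalIntegrable _ _)]
  rw [h2]
  exact ((h1 x).sub ((h1 (x - 1 / q)).comp_sub_const x (1 / q))).const_mul q

/-- The windows `[x - (α+1)/q, x - α/q]` tile the line. -/
theorem hasSum_movingAverage {q : ℝ} (hq : 0 < q) {f : ℝ → ℝ} (hf : Integrable f) (x : ℝ) :
    HasSum (fun α : ℤ => movingAverage q f (x - (α : ℝ) / q)) (q * ∫ t, f t) := by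
  have hi : Integrable fun t => f (t / q) := hf.comp_div hq.ne'
  have h := (hi.hasSum_intervalIntegral (q * x))
  rw [Measure.integral_comp_div, abs_of_pos hq, smul_eq_mul] at h
  -- Reindexing by `α ↦ -α - 1` turns the unit interval starting at `qx + α` into the one ending at
  -- `qx - α`.
  rw [← ((Equiv.neg ℤ).trans (Equiv.subRight 1)).hasSum_iff] at h
  refine h.congr_fun ?_
  intro α
  simp only [Function.comp, Equiv.trans_apply, Equiv.neg_apply, Equiv.subRight_apply]
  rw [intervalIntegral.integral_comp_div f hq.ne', movingAverage, smul_eq_mul]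
  congr 2
  · push_cast; field_simp; ring
  · push_cast; field_simp; ring

theorem finite_int_sub_div_mem_Icc {q : ℝ} (hq : 0 < q) (a b L : ℝ) :
    {α : ℤ | ∃ x ∈ Icc a b, x - (α : ℝ) / q ∈ Icc 0 L}.Finite := by
  refine (finite_Icc ⌊q * (a - L)⌋ ⌈q * b⌉).subset ?_
  rintro α ⟨x, ⟨hxa, hxb⟩, h0, hL⟩
  have hα : (α : ℝ) = q * ((α : ℝ) / q) := by field_simp
  constructor
  · have : q * (a - L) ≤ α := by rw [hα]; gcongr; linarith
    exact_mod_cast (Int.floor_le _).trans this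
  · have : (α : ℝ) ≤ q * b := by rw [hα]; gcongr; linarith
    exact_mod_cast this.trans (Int.le_ceil _)

theorem exists_hasSum_translates {q : ℝ} (hq : 0 < q) {f : ℝ → ℝ} {L : ℝ}
    (hf : ∀ x, x ∉ Icc 0 L → f x = 0) (γ : ℤ → ℝ) (a b : ℝ) :
    ∃ s : Finset ℤ, ∀ x ∈ Icc a b, (∀ α ∉ s, f (x - (α : ℝ) / q) = 0) ∧
      HasSum (fun α : ℤ => γ α * f (x - (α : ℝ) / q)) (∑ α ∈ s, γ α * f (x - (α : ℝ) / q)) := by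
  refine ⟨(finite_int_sub_div_mem_Icc hq a b L).toFinset, fun x hx => ?_⟩
  have h : ∀ α ∉ (finite_int_sub_div_mem_Icc hq a b L).toFinset, f (x - (α : ℝ) / q) = 0 := by
    intro α hα
    refine hf _ fun hmem => hα ?_
    rw [Finite.mem_toFinset]
    exact ⟨x, hx, hmem⟩
  exact ⟨h, hasSum_sum_of_ne_finset_zero fun α hα => by rw [h α hα, mul_zero]⟩

/-- Summation by parts: the derivative of a moving average is `q` times the difference of `f` at the
ends of the window, and adjacent windows share an end. Compact support makes the series locally
finite. -/
theorem hasDerivAt_tsum_movingAverage {q : ℝ} (hq : 0 < q) {f : ℝ → ℝ} (hf : Continuous f)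
    {L : ℝ} (hfL : ∀ x, x ∉ Icc 0 L → f x = 0)
    (hgL : ∀ x, x ∉ Icc 0 L → movingAverage q f x = 0) (γ : ℤ → ℝ) {d x : ℝ}
    (hd : HasSum (fun α : ℤ => (γ α - γ (α - 1)) * f (x - (α : ℝ) / q)) d) :
    HasDerivAt (fun y => ∑' α : ℤ, γ α * movingAverage q f (y - (α : ℝ) / q)) (q * d) x := by
  obtain ⟨s, hs⟩ := exists_hasSum_translates hq hgL γ (x - 1) (x + 1)
  have hmem : ∀ᶠ y in 𝓝 x, y ∈ Icc (x - 1) (x + 1) :=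
    Icc_mem_nhds (by linarith) (by linarith)
  have hder : ∀ α : ℤ, HasDerivAt (fun y => movingAverage q f (y - (α : ℝ) / q))
      (q * (f (x - (α : ℝ) / q) - f (x - ((α + 1 : ℤ) : ℝ) / q))) x := by
    intro α
    have h := (hasDerivAt_movingAverage q hf (x - (α : ℝ) / q)).comp_sub_const x ((α : ℝ) / q)
    rwa [show x - (α : ℝ) / q - 1 / q = x - ((α + 1 : ℤ) : ℝ) / q by push_cast; ring] at h
  obtain ⟨_, h₁⟩ := exists_hasSum_translates hq hfL γ x x
  obtain ⟨_, h₂⟩ := exists_hasSum_translates hq hfL (fun α => γ (α - 1)) x x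
  have h₁ := (h₁ x ⟨le_rfl, le_rfl⟩).2
  have h₂ := (h₂ x ⟨le_rfl, le_rfl⟩).2
  have hd' := hd.unique ((h₁.sub h₂).congr_fun fun α => by ring)
  rw [← (Equiv.addRight (1 : ℤ)).hasSum_iff] at h₂
  have h₃ : HasSum (fun α : ℤ =>
      γ α * (q * (f (x - (α : ℝ) / q) - f (x - ((α + 1 : ℤ) : ℝ) / q)))) (q * d) := by
    rw [hd']
    refine ((h₁.sub h₂).mul_left q).congr_fun fun α => ?_
    simp only [Function.comp, Equiv.coe_addRight, add_sub_cancel_right]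
    ring
  have hzero : ∀ α ∉ s,
      γ α * (q * (f (x - (α : ℝ) / q) - f (x - ((α + 1 : ℤ) : ℝ) / q))) = 0 := by
    intro α hα
    -- Off `s` the translate vanishes on a whole neighbourhood of `x`, so its derivative vanishes
    -- too.
    have h0 : (fun y => movingAverage q f (y - (α : ℝ) / q)) =ᶠ[𝓝 x] fun _ => 0 :=
      hmem.mono fun y hy => (hs y hy).1 α hα
    rw [(hder α).unique ((hasDerivAt_const x (0 : ℝ)).congr_of_eventuallyEq h0), mul_zero]
  rw [h₃.unique (hasSum_sum_of_ne_finset_zero hzero)]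
  refine HasDerivAt.congr_of_eventuallyEq
    (HasDerivAt.fun_sum fun α _ => (hder α).const_mul (γ α)) ?_
  exact hmem.mono fun y hy => (hs y hy).2.tsum_eq

/-- If the derivative of `F` is a series of translates of `f`, then `F` is a series of translates
of the moving average of `f`. -/
theorem exists_hasSum_movingAverage {q : ℝ} (hq : 0 < q) {f : ℝ → ℝ} (hf : Continuous f)
    {L : ℝ} (hfL : ∀ x, x ∉ Icc 0 L → f x = 0)
    (hgL : ∀ x, x ∉ Icc 0 L → movingAverage q f x = 0) (hf1 : ∫ x, f x = 1)
    {F F' : ℝ → ℝ} (hF : ∀ x, HasDerivAt F (F' x) x) {β : ℤ → ℝ}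
    (hβ : ∀ x, HasSum (fun α : ℤ => β α * f (x - (α : ℝ) / q)) (F' x)) :
    ∃ γ : ℤ → ℝ, ∀ x, HasSum (fun α : ℤ => γ α * movingAverage q f (x - (α : ℝ) / q)) (F x) := by
  obtain ⟨γ, hγ⟩ := exists_int_backward_difference fun α => β α / q
  have hder : ∀ x, HasDerivAt (fun y => ∑' α : ℤ, γ α * movingAverage q f (y - (α : ℝ) / q))
      (F' x) x := by
    intro x
    have h := hasDerivAt_tsum_movingAverage hq hf hfL hgL γ (x := x) (d := F' x / q)
      (((hβ x).div_const q).congr_fun fun α => by rw [hγ]; ring)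
    rwa [mul_div_cancel₀ _ hq.ne'] at h
  set G := fun y => ∑' α : ℤ, γ α * movingAverage q f (y - (α : ℝ) / q) with hG
  have hconst : ∀ x, F x - G x = F 0 - G 0 := fun x =>
    is_const_of_deriv_eq_zero (f := fun x => F x - G x)
      (fun y => ((hF y).sub (hder y)).differentiableAt)
      (fun y => by rw [((hF y).fun_sub (hder y)).deriv, sub_self]) x 0
  -- The translates of the moving average sum to `q`, so this shift of the coefficients adds exactly
  -- the missing constant.
  refine ⟨fun α => γ α + (F 0 - G 0) / q, fun x => ?_⟩
  obtain ⟨_, h₁⟩ := exists_hasSum_translates hq hgL γ x x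
  have h₁ := (h₁ x ⟨le_rfl, le_rfl⟩).2.summable.hasSum
  have hfi : Integrable f := by
    refine hf.integrable_of_hasCompactSupport (HasCompactSupport.of_support_subset_isCompact
      (isCompact_Icc (a := (0 : ℝ)) (b := L)) fun y hy => ?_)
    by_contra hy'
    exact hy (hfL y hy')
  have h₂ := (hasSum_movingAverage hq hfi x).mul_left ((F 0 - G 0) / q)
  have hsum : F x = G x + (F 0 - G 0) / q * (q * ∫ t, f t) := by
    rw [hf1, ← hconst x]
    field_simp
    ring
  rw [hsum]
  exact (h₁.add h₂).congr_fun fun α => by ring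

/-! ### Continuity, support and mass of the refinable functions -/

theorem continuous_ripplet (n : ℕ) (hn : 1 ≤ n) (μ : ℝ) (hμ : 1 < μ) (m : ℕ) (hm : 1 ≤ m) :
    Continuous (ripplet n μ m) :=
  Complex.continuous_re.comp
    (continuous_angularFourierInv (integrable_rippletFourier n hn μ hμ m hm))

theorem integral_mul_ripplet (n : ℕ) (hn : 1 ≤ n) (μ : ℝ) (hμ : 1 < μ) (m : ℕ) (hm : 1 ≤ m)
    {g : ℝ → ℝ} (hg : ContDiff ℝ (⊤ : ℕ∞) g) (hgc : HasCompactSupport g) {c : ℝ}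
    (h : ∀ y ∈ Icc (0 : ℝ) ((n + 1) / 2 ^ m), g y = c) :
    ∫ x, g x * ripplet n μ m x = c := by
  have h1 := integral_mul_rippletC n hn μ hμ m hm hg hgc h
  simp only [← ofReal_ripplet n hn, ← Complex.ofReal_mul] at h1
  rw [integral_complex_ofReal] at h1
  exact_mod_cast h1

theorem ripplet_eq_zero (n : ℕ) (hn : 1 ≤ n) (μ : ℝ) (hμ : 1 < μ) (m : ℕ) (hm : 1 ≤ m) (x : ℝ)
    (hx : x ∉ Icc (0 : ℝ) ((n + 1) / 2 ^ m)) : ripplet n μ m x = 0 := by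
  have hc := continuous_ripplet n hn μ hμ m hm
  have hU : IsOpen (Icc (0 : ℝ) ((n + 1) / 2 ^ m))ᶜ := isClosed_Icc.isOpen_compl
  have h := hU.ae_eq_zero_of_integral_contDiff_smul_eq_zero (μ := volume)
    (hc.locallyIntegrable.locallyIntegrableOn _) fun g hg hgc hgU => by
      simp only [smul_eq_mul]
      refine integral_mul_ripplet n hn μ hμ m hm hg hgc fun y hy => ?_
      by_contra hne
      exact hgU (subset_tsupport g hne) hy
  exact Measure.eqOn_open_of_ae_eq (μ := volume) (g := fun _ => 0)
    ((ae_restrict_iff' hU.measurableSet).mpr h) hU hc.continuousOn continuousOn_const hx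

theorem integral_ripplet (n : ℕ) (hn : 1 ≤ n) (μ : ℝ) (hμ : 1 < μ) (m : ℕ) (hm : 1 ≤ m) :
    ∫ x, ripplet n μ m x = 1 := by
  have hR : 0 < ((n : ℝ) + 1) / 2 ^ m := by positivity
  let χ : ContDiffBump (0 : ℝ) := ⟨_, _, hR, lt_add_one _⟩
  have h1 : ∀ y ∈ Icc (0 : ℝ) ((n + 1) / 2 ^ m), χ y = 1 := fun y hy =>
    χ.one_of_mem_closedBall (by
      rw [mem_closedBall_zero_iff, Real.norm_of_nonneg hy.1]
      exact hy.2)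
  rw [← integral_mul_ripplet n hn μ hμ m hm χ.contDiff χ.hasCompactSupport h1]
  congr 1
  funext x
  by_cases hx : x ∈ Icc (0 : ℝ) ((n + 1) / 2 ^ m)
  · rw [h1 x hx, one_mul]
  · rw [ripplet_eq_zero n hn μ hμ m hm x hx, mul_zero]

/-- The integral of a non-integrable function is 0 by convention, whereas this one is 1. -/
theorem integrable_ripplet (n : ℕ) (hn : 1 ≤ n) (μ : ℝ) (hμ : 1 < μ) (m : ℕ) (hm : 1 ≤ m) :
    Integrable (ripplet n μ m) := by
  by_contra h
  have := integral_ripplet n hn μ hμ m hm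
  rw [integral_undef h] at this
  exact zero_ne_one this

/-- The two pairs of indices are independent so as to cover both `(n, m)` to `(n+1, m)` and `(n, 1)`
to `(n+1, 0)`. -/
theorem ripplet_eq_movingAverage {n k : ℕ} (hn : 1 ≤ n) (hk : 1 ≤ k) {μ : ℝ} (hμ : 1 < μ)
    {m l : ℕ} (hm : 1 ≤ m) {q : ℝ}
    (h : ∀ ω, rippletFourier k μ l ω = boxFourier q ω * rippletFourier n μ m ω) :
    ripplet k μ l = movingAverage q (ripplet n μ m) := by
  funext x
  have h1 := angularFourierInv_boxFourier_mul q (integrable_rippletFourier n hn μ hμ m hm) x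
  simp only [← h] at h1
  have h2 : ∀ t, angularFourierInv (rippletFourier n μ m) t = (ripplet n μ m t : ℂ) :=
    fun t => (ofReal_ripplet n hn μ m t).symm
  have h3 : angularFourierInv (rippletFourier k μ l) x = (ripplet k μ l x : ℂ) :=
    (ofReal_ripplet k hk μ l x).symm
  simp only [h2, intervalIntegral.integral_ofReal] at h1
  change angularFourierInv (rippletFourier k μ l) x = _ at h1
  rw [h3] at h1
  exact_mod_cast h1

/-! ### Polynomials in the spaces -/

theorem eval_mem_rippletSpace (n : ℕ) (hn : 1 ≤ n) (μ : ℝ) (hμ : 1 < μ) (m : ℕ) (hm : 1 ≤ m)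
    (p : Polynomial ℝ) (hp : p.degree < (n - 1 : ℕ)) :
    (fun x => p.eval x) ∈ rippletSpace n μ m := by
  induction n, hn using Nat.le_induction generalizing p with
  | base =>
    -- At `n = 1` the bound reads `degree < 0`, which `degree` (unlike `natDegree`) grants only to
    -- the zero polynomial.
    have : p = 0 := by
      rw [← Polynomial.degree_eq_bot]
      simpa using hp
    refine ⟨0, fun x => ?_⟩
    simp only [this, Pi.zero_apply, zero_mul, Polynomial.eval_zero]
    exact hasSum_zero
  | succ n hn ih =>
    have hq : (0 : ℝ) < 2 ^ m := by positivity
    have hd : p.derivative.degree < (n - 1 : ℕ) := by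
      rw [Polynomial.degree_lt_iff_coeff_zero] at hp ⊢
      intro k hk
      rw [Polynomial.coeff_derivative, hp (k + 1) (by omega), zero_mul]
    obtain ⟨β, hβ⟩ := ih p.derivative hd
    have heq : ripplet (n + 1) μ m = movingAverage (2 ^ m) (ripplet n μ m) :=
      ripplet_eq_movingAverage hn (by omega) hμ hm (rippletFourier_succ_left n hn μ m hm)
    obtain ⟨γ, hγ⟩ := exists_hasSum_movingAverage hq (continuous_ripplet n hn μ hμ m hm)
      -- The longer support, that for `n + 1`, serves for both functions.
      (L := ((n : ℝ) + 1 + 1) / 2 ^ m)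
      (fun x hx => ripplet_eq_zero n hn μ hμ m hm x fun hx' => hx ⟨hx'.1, hx'.2.trans (by
        gcongr
        linarith)⟩)
      (fun x hx => by
        rw [← heq]
        exact ripplet_eq_zero (n + 1) (by omega) μ hμ m hm x (by exact_mod_cast hx))
      (integral_ripplet n hn μ hμ m hm) p.hasDerivAt hβ
    exact ⟨γ, by rw [heq]; exact hγ⟩

theorem const_mem_rippletSpace_zero (n : ℕ) (hn : 1 ≤ n) (μ : ℝ) (hμ : 1 < μ) (c : ℝ) :
    (fun _ => c) ∈ rippletSpace (n + 1) μ 0 := by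
  refine ⟨fun _ => c, fun x => ?_⟩
  rw [ripplet_eq_movingAverage hn (by omega) hμ le_rfl
    (rippletFourier_level_zero n hn μ)]
  have h := (hasSum_movingAverage one_pos (integrable_ripplet n hn μ hμ 1 le_rfl) x).mul_left c
  rw [integral_ripplet n hn μ hμ 1 le_rfl] at h
  simpa using h

theorem mainTheorem3 (n : ℕ) (hn : 2 ≤ n) (μ : ℝ) (hμ : 1 < μ) :
    (∀ m : ℕ, 0 < m → ∀ p : Polynomial ℝ, p.natDegree ≤ n - 2 →
      (fun x : ℝ => p.eval x) ∈ rippletSpace n μ m) ∧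
    (∀ c : ℝ, (fun _ : ℝ => c) ∈ rippletSpace n μ 0) := by
  refine ⟨fun m hm p hp => eval_mem_rippletSpace n (by omega) μ hμ m hm p ?_, fun c => ?_⟩
  · refine Polynomial.degree_le_natDegree.trans_lt ?_
    exact_mod_cast (by omega : p.natDegree < n - 1)
  · obtain ⟨k, rfl⟩ := Nat.exists_eq_add_of_le' hn
    exact const_mem_rippletSpace_zero (k + 1) (by omega) μ hμ c
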